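/- Let $n \ge 1$, $t \in (0,1]$, and let $X_n, Y_n$ be independent $n\times n$ GUE matrices, normalised so that the density is proportional to $e^{-\mathrm{Tr}(X^2)/2}$ on Hermitian matrices (the diagonal entries are standard real Gaussian variables, the entries above the diagonal are centred complex Gaussian with independent real and imaginary parts of variance $1/2$, all of these being independent). Let $A_{n,t}$ be a random matrix with the law of $\sqrt{\tfrac{1+t}{2}}\,X_n + i\sqrt{\tfrac{1-t}{2}}\,Y_n$ (the Elliptic Ginibre Ensemble), and for $|z|<1$ put $$f_{n,t}(z) = \det\Big((1+tz^2)I_n - \tfrac{z}{\sqrt n}A_{n,t}\Big)\,e^{-\frac{n t z^2}{2}}.$$ Let $\mathrm{He}_k$ ($k \ge 0$) be the (probabilists') Hermite polynomials, i.e. the monic orthogonal polynomials with respect to $e^{-x^2/2}\,dx$ on $\mathbb{R}$, and for $z \neq 0$ let $g_t(z) = \tfrac1z + tz$. Then for every $z\in\mathbb{C}$ with $0<|z|<1$, the variable $|f_{n,t}(z)|^2$ is integrable and $$\mathbb{E}\big[|f_{n,t}(z)|^2\big] = \frac{n!\,|z|^{2n}}{n^n}\,\big|e^{-ntz^2}\big|\,\sum_{k=0}^{n}\frac{t^k}{k!}\,\Big|\mathrm{He}_k\Big(\sqrt{\tfrac{n}{t}}\;g_t(z)\Big)\Big|^2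 .$$ -/

import Mathlib

open MeasureTheory ProbabilityTheory

namespace EllipticGinibre

noncomputable section

/-- Matrices carry the product sigma-algebra of their entries. -/
instance matrixMeasurableSpace (n : ℕ) : MeasurableSpace (Matrix (Fin n) (Fin n) ℂ) :=
  (inferInstance : MeasurableSpace (Fin n → Fin n → ℂ))

/-- The Hermitian matrix built from real parameters: `g (i, i)` on the diagonal,
`(g (i, j) + I * g (j, i)) / √2` above the diagonal, and the conjugate below it. -/
def hermitianOfReal (n : ℕ) (g : Fin n × Fin n → ℝ) : Matrix (Fin n) (Fin n) ℂ :=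
  Matrix.of fun i j =>
    if i = j then (g (i, i) : ℂ)
    else if i < j then ((g (i, j) : ℂ) + Complex.I * (g (j, i) : ℂ)) / (Real.sqrt 2 : ℂ)
    else ((g (j, i) : ℂ) - Complex.I * (g (i, j) : ℂ)) / (Real.sqrt 2 : ℂ)

/-- The law of the Gaussian Unitary Ensemble of size `n`, with density proportional to
`exp (-Tr (X ^ 2) / 2)` on Hermitian matrices: the diagonal entries are standard real Gaussian,
the entries above the diagonal are standard complex Gaussian (`E |X i j| ^ 2 = 1`), all of these
independent. -/
def gueLaw (n : ℕ) : Measure (Matrix (Fin n) (Fin n) ℂ) :=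
  (Measure.pi fun _ : Fin n × Fin n => gaussianReal 0 1).map (hermitianOfReal n)

/-- The combination `√((1 + t) / 2) X + i √((1 - t) / 2) Y`. -/
def ellipticCombination (n : ℕ) (t : ℝ)
    (XY : Matrix (Fin n) (Fin n) ℂ × Matrix (Fin n) (Fin n) ℂ) : Matrix (Fin n) (Fin n) ℂ :=
  (Real.sqrt ((1 + t) / 2) : ℂ) • XY.1 + (Complex.I * (Real.sqrt ((1 - t) / 2) : ℂ)) • XY.2

/-- The law of the Elliptic Ginibre Ensemble of size `n` with parameter `t`: the law of
`√((1 + t) / 2) X + i √((1 - t) / 2) Y` for independent GUE matrices `X`, `Y` of size `n`. -/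
def ellipticGinibreLaw (n : ℕ) (t : ℝ) : Measure (Matrix (Fin n) (Fin n) ℂ) :=
  ((gueLaw n).prod (gueLaw n)).map (ellipticCombination n t)

/-- The normalised characteristic polynomial
`det (1 + t z ^ 2 - (z / √n) A) * exp (-n t z ^ 2 / 2)` of a matrix `A`. -/
def normalisedCharpoly (n : ℕ) (t : ℝ) (A : Matrix (Fin n) (Fin n) ℂ) (z : ℂ) : ℂ :=
  ((1 + (t : ℂ) * z ^ 2) • (1 : Matrix (Fin n) (Fin n) ℂ)
      - (z / (Real.sqrt (n : ℝ) : ℂ)) • A).det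
    * Complex.exp (-((n : ℂ) * (t : ℂ) * z ^ 2) / 2)

/-- The map `z ↦ 1 / z + t z`. -/
def g (t : ℝ) (z : ℂ) : ℂ := z⁻¹ + (t : ℂ) * z

theorem measurable_hermitianOfReal (n : ℕ) : Measurable (hermitianOfReal n) := by
  refine measurable_pi_lambda _ fun i => measurable_pi_lambda _ fun j => ?_
  simp only [hermitianOfReal, Matrix.of_apply]
  split_ifs <;> fun_prop

theorem measurable_ellipticCombination (n : ℕ) (t : ℝ) :
    Measurable (ellipticCombination n t) := by
  refine measurable_pi_lambda _ fun i => measurable_pi_lambda _ fun j => ?_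
  have h1 : Measurable fun XY : Matrix (Fin n) (Fin n) ℂ × Matrix (Fin n) (Fin n) ℂ =>
      XY.1 i j := (measurable_pi_apply j).comp ((measurable_pi_apply i).comp measurable_fst)
  have h2 : Measurable fun XY : Matrix (Fin n) (Fin n) ℂ × Matrix (Fin n) (Fin n) ℂ =>
      XY.2 i j := (measurable_pi_apply j).comp ((measurable_pi_apply i).comp measurable_snd)
  simp only [ellipticCombination, Matrix.add_apply, Matrix.smul_apply, smul_eq_mul]
  exact (h1.const_mul _).add (h2.const_mul _)

instance isProbabilityMeasure_gueLaw (n : ℕ) : IsProbabilityMeasure (gueLaw n) :=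
  Measure.isProbabilityMeasure_map (measurable_hermitianOfReal n).aemeasurable

instance isProbabilityMeasure_ellipticGinibreLaw (n : ℕ) (t : ℝ) :
    IsProbabilityMeasure (ellipticGinibreLaw n t) :=
  Measure.isProbabilityMeasure_map (measurable_ellipticCombination n t).aemeasurable

end

/-!
Write `A = A_{n,t}`. Apart from `E[A i j * A j i] = t` for `i ≠ j`, the entries of `A` behave like
independent standard complex Gaussians, so the Wick products of sets of distinct entries form an
orthonormal system in `L²`. Up to an explicit factor, `f_{n,t}(z)` is `det (w - A)` with
`w = √n g_t(z)`. Expanding over permutations and replacing each `A i j * A j i` by its Wick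
polynomial plus `t`, a permutation of a subset `S` contributes its Wick product with coefficient,
up to sign, a sum over the involutions of the complement of `S`: a fixed point has weight `w` and a
transposition weight `-t`. As `He_k` is the signed matching polynomial of the complete graph on `k`
vertices, this coefficient is `t ^ (k / 2) * He_k (w / √t)` with `k = n - |S|`. Parseval's identity
then sums the squared coefficients over the `n! / k!` pairs of a subset of size `n - k` and a
permutation of it.
-/

open scoped ComplexConjugate

theorem sum_mul_conj_sum {κ : Type*} [Fintype κ] (c d u : κ → ℂ) :
    (∑ i, c i * u i) * conj (∑ j, d j * u j) =
      ∑ i, ∑ j, c i * conj (d j) * (u i * conj (u j)) := by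
  rw [map_sum, Finset.sum_mul_sum]
  refine Finset.sum_congr rfl fun i _ => Finset.sum_congr rfl fun j _ => ?_
  rw [map_mul]; ring

/-- A family of complex random variables that is orthonormal in `L²(μ)`, stated for functions
rather than for almost everywhere classes. -/
structure IsOrthonormalSystem {Ω κ : Type*} [MeasurableSpace Ω] [DecidableEq κ] (μ : Measure Ω)
    (u : κ → Ω → ℂ) : Prop where
  integrable_mul_conj (i j : κ) : Integrable (fun ω => u i ω * conj (u j ω)) μ
  integral_mul_conj (i j : κ) : ∫ ω, u i ω * conj (u j ω) ∂μ = if i = j then 1 else 0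

namespace IsOrthonormalSystem

variable {Ω Ω' κ κ' : Type*} [MeasurableSpace Ω] [MeasurableSpace Ω'] [DecidableEq κ]
  [DecidableEq κ'] {μ : Measure Ω} {u : κ → Ω → ℂ}

theorem comp_injective (hu : IsOrthonormalSystem μ u) {f : κ' → κ} (hf : Function.Injective f) :
    IsOrthonormalSystem μ fun i => u (f i) where
  integrable_mul_conj i j := hu.integrable_mul_conj (f i) (f j)
  integral_mul_conj i j := by simp only [hu.integral_mul_conj, hf.eq_iff]

theorem map_iff {v : κ → Ω' → ℂ} {T : Ω → Ω'} (hT : AEMeasurable T μ)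
    (hv : ∀ i, AEStronglyMeasurable (v i) (μ.map T)) :
    IsOrthonormalSystem (μ.map T) v ↔ IsOrthonormalSystem μ fun i => v i ∘ T := by
  have meas (i j : κ) : AEStronglyMeasurable (fun ω => v i ω * conj (v j ω)) (μ.map T) :=
    (hv i).mul (Complex.continuous_conj.comp_aestronglyMeasurable (hv j))
  have integrable_iff (i j : κ) := integrable_map_measure (meas i j) hT
  have integral_eq (i j : κ) := integral_map hT (meas i j)
  refine ⟨fun h => ⟨fun i j => ?_, fun i j => ?_⟩, fun h => ⟨fun i j => ?_, fun i j => ?_⟩⟩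
  · exact (integrable_iff i j).1 (h.integrable_mul_conj i j)
  · exact (integral_eq i j).symm.trans (h.integral_mul_conj i j)
  · exact (integrable_iff i j).2 (h.integrable_mul_conj i j)
  · exact (integral_eq i j).trans (h.integral_mul_conj i j)

theorem prod {ν : Measure Ω'} [SFinite μ] [SFinite ν] {v : κ' → Ω' → ℂ}
    (hu : IsOrthonormalSystem μ u) (hv : IsOrthonormalSystem ν v) :
    IsOrthonormalSystem (μ.prod ν) fun (i : κ × κ') ω => u i.1 ω.1 * v i.2 ω.2 := by
  have split (i j : κ × κ') (ω : Ω × Ω') :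
      u i.1 ω.1 * v i.2 ω.2 * conj (u j.1 ω.1 * v j.2 ω.2) =
        u i.1 ω.1 * conj (u j.1 ω.1) * (v i.2 ω.2 * conj (v j.2 ω.2)) := by
    rw [map_mul]; ring
  refine ⟨fun i j => ?_, fun i j => ?_⟩ <;> simp only [split]
  · exact (hu.integrable_mul_conj _ _).mul_prod (hv.integrable_mul_conj _ _)
  · rw [integral_prod_mul (fun ω => u i.1 ω * conj (u j.1 ω)) fun ω => v i.2 ω * conj (v j.2 ω),
      hu.integral_mul_conj, hv.integral_mul_conj]
    simp only [Prod.ext_iff, ite_and, ite_mul, one_mul, zero_mul]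

variable [Fintype κ]

theorem integrable_sum_mul_conj_sum (hu : IsOrthonormalSystem μ u) (c d : κ → ℂ) :
    Integrable (fun ω => (∑ i, c i * u i ω) * conj (∑ i, d i * u i ω)) μ := by
  simp only [sum_mul_conj_sum]
  exact integrable_finsetSum _ fun i _ => integrable_finsetSum _ fun j _ =>
    (hu.integrable_mul_conj i j).const_mul _

theorem integral_sum_mul_conj_sum (hu : IsOrthonormalSystem μ u) (c d : κ → ℂ) :
    ∫ ω, (∑ i, c i * u i ω) * conj (∑ i, d i * u i ω) ∂μ = ∑ i, c i * conj (d i) := by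
  have integrable (i j : κ) : Integrable (fun ω => c i * conj (d j) * (u i ω * conj (u j ω))) μ :=
    (hu.integrable_mul_conj i j).const_mul _
  simp only [sum_mul_conj_sum]
  rw [integral_finsetSum _ fun i _ => integrable_finsetSum _ fun j _ => integrable i j]
  simp only [integral_finsetSum _ fun j _ => integrable _ j, integral_const_mul,
    hu.integral_mul_conj, mul_ite, mul_one, mul_zero, Finset.sum_ite_eq, Finset.mem_univ, if_true]

theorem linearCombination (hu : IsOrthonormalSystem μ u) {C : Matrix κ' κ ℂ}
    (hC : C * C.conjTranspose = 1) :
    IsOrthonormalSystem μ fun i ω => ∑ k, C i k * u k ω where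
  integrable_mul_conj i j := hu.integrable_sum_mul_conj_sum (C i) (C j)
  integral_mul_conj i j := by
    rw [hu.integral_sum_mul_conj_sum, ← Matrix.one_apply, ← hC, Matrix.mul_apply]
    rfl

theorem integrable_norm_sum_sq (hu : IsOrthonormalSystem μ u) (c : κ → ℂ) :
    Integrable (fun ω => ‖∑ i, c i * u i ω‖ ^ 2) μ := by
  refine (hu.integrable_sum_mul_conj_sum c c).re.congr (.of_forall fun ω => ?_)
  simp only [Complex.mul_conj', RCLike.re_to_complex]
  norm_cast

theorem integral_norm_sum_sq (hu : IsOrthonormalSystem μ u) (c : κ → ℂ) :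
    ∫ ω, ‖∑ i, c i * u i ω‖ ^ 2 ∂μ = ∑ i, ‖c i‖ ^ 2 := by
  have h := hu.integral_sum_mul_conj_sum c c
  simp only [Complex.mul_conj', ← Complex.ofReal_pow, ← Complex.ofReal_sum,
    integral_complex_ofReal] at h
  exact_mod_cast h

end IsOrthonormalSystem

section Independence

variable {Ω : Type*} [MeasurableSpace Ω] {P : Measure Ω}

theorem iIndepFun_curry {ι : Type*} {κ : ι → Type*} {E : (i : ι) → κ i → Type*}
    [∀ i j, MeasurableSpace (E i j)] {X : (p : (i : ι) × κ i) → Ω → E p.1 p.2}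
    (mX : ∀ p, Measurable (X p)) (hX : iIndepFun X P) :
    iIndepFun (fun i ω (j : κ i) => X ⟨i, j⟩ ω) P := by
  have := hX.isProbabilityMeasure
  have (i : ι) (j : κ i) : IsProbabilityMeasure (P.map (X ⟨i, j⟩)) :=
    Measure.isProbabilityMeasure_map (mX _).aemeasurable
  have row_law (i : ι) : P.map (fun ω (j : κ i) => X ⟨i, j⟩ ω) =
      Measure.infinitePi fun j => P.map (X ⟨i, j⟩) :=
    (hX.precomp (g := Sigma.mk i) sigma_mk_injective).map_fun_eq_infinitePi_map fun _ => mX _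
  rw [iIndepFun_iff_map_fun_eq_infinitePi_map (by fun_prop)]
  simp only [row_law]
  rw [← Measure.infinitePi_map_piCurry fun i j => P.map (X ⟨i, j⟩),
    ← hX.map_fun_eq_infinitePi_map mX, Measure.map_map (by fun_prop) (by fun_prop)]
  rfl

theorem iIndepFun_of_dependsOn_fiber {α β E : Type*} [MeasurableSpace E] [Nonempty E]
    {X : α → Ω → E} (mX : ∀ a, Measurable (X a)) (hX : iIndepFun X P) (q : α → β) {F : β → Type*}
    [∀ b, MeasurableSpace (F b)] {f : (b : β) → (α → E) → F b} (mf : ∀ b, Measurable (f b))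
    (hf : ∀ b, DependsOn (f b) (q ⁻¹' {b})) :
    iIndepFun (fun b ω => f b fun a => X a ω) P := by
  classical
  let extend (b : β) (x : {a // q a = b} → E) (a : α) : E :=
    if h : q a = b then x ⟨a, h⟩ else Classical.arbitrary E
  have measurable_extend (b : β) : Measurable (extend b) := by
    refine measurable_pi_lambda _ fun a => ?_
    by_cases h : q a = b <;> simp only [extend, h, dite_true, dite_false] <;> fun_prop
  have fibers : iIndepFun (fun b ω (a : {a // q a = b}) => X a ω) P :=
    iIndepFun_curry (κ := fun b => {a // q a = b}) (E := fun _ _ => E) (X := fun p => X p.2)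
      (fun p => mX p.2)
      (hX.precomp (g := fun p : (b : β) × {a // q a = b} => (p.2 : α))
        (Equiv.sigmaFiberEquiv q).injective)
  convert fibers.comp (fun b => f b ∘ extend b) (fun b => (mf b).comp (measurable_extend b)) using 3
    with b ω
  refine hf b fun a ha => ?_
  have ha : q a = b := ha
  simp only [extend, ha, dite_true]

theorem integrable_prod_of_iIndepFun {β 𝕜 : Type*} [Fintype β] [RCLike 𝕜] {X : β → Ω → 𝕜}
    (hX : iIndepFun X P) (iX : ∀ b, Integrable (X b) P) :
    Integrable (fun ω => ∏ b, X b ω) P := by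
  have := hX.isProbabilityMeasure
  have aemeas (b : β) := (iX b).aemeasurable
  have (b : β) := Measure.isProbabilityMeasure_map (aemeas b)
  have h := Integrable.fintype_prod (μ := fun b => P.map (X b)) (f := fun _ x => x)
    fun b => (integrable_map_measure aestronglyMeasurable_id (aemeas b)).2 (iX b)
  rw [← hX.map_fun_eq_pi_map aemeas] at h
  exact h.comp_aemeasurable (aemeasurable_pi_lambda _ aemeas)

theorem IsOrthonormalSystem.prod_of_iIndepFun {S : Type*} [Fintype S] {κ : S → Type*}
    [∀ s, DecidableEq (κ s)] {u : (s : S) → κ s → Ω → ℂ}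
    (hu : ∀ s, IsOrthonormalSystem P (u s)) (hI : iIndepFun (fun s ω k => u s k ω) P) :
    IsOrthonormalSystem P fun (F : (s : S) → κ s) ω => ∏ s, u s (F s) ω := by
  have independent (F G : (s : S) → κ s) :
      iIndepFun (fun s ω => u s (F s) ω * conj (u s (G s) ω)) P :=
    hI.comp (fun s x => x (F s) * conj (x (G s))) fun s => by fun_prop
  refine ⟨fun F G => ?_, fun F G => ?_⟩ <;> simp only [map_prod, ← Finset.prod_mul_distrib]
  · exact integrable_prod_of_iIndepFun (independent F G) fun s => (hu s).integrable_mul_conj _ _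
  · rw [(independent F G).integral_fun_prod_eq_prod_integral fun s =>
      ((hu s).integrable_mul_conj _ _).aestronglyMeasurable]
    simp only [(hu _).integral_mul_conj, Finset.prod_ite_zero, Finset.prod_const_one,
      Finset.mem_univ, true_implies, funext_iff]

end Independence

theorem integrable_pow_gaussianReal (v : NNReal) (k : ℕ) :
    Integrable (fun x : ℝ => x ^ k) (gaussianReal 0 v) := by
  refine (integrable_norm_iff (by fun_prop)).1 ?_
  simpa using (memLp_id_gaussianReal (μ := 0) (v := v) k).integrable_norm_pow'

theorem integral_pow_add_two_gaussianReal (v : NNReal) (k : ℕ) :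
    ∫ x, x ^ (k + 2) ∂(gaussianReal 0 v) = (k + 1) * v * ∫ x, x ^ k ∂(gaussianReal 0 v) := by
  have moment (m : ℕ) : ∫ x, x ^ m ∂(gaussianReal 0 v) =
      iteratedDeriv m (fun s : ℝ => Real.exp (v * s ^ 2 / 2)) 0 := by
    simpa [mgf_id_gaussianReal] using
      (iteratedDeriv_mgf_zero (X := id) (μ := gaussianReal 0 v) (by simp) m).symm
  have deriv_exp : deriv (fun s : ℝ => Real.exp (v * s ^ 2 / 2)) =
      fun s => id s * (v * Real.exp (v * s ^ 2 / 2)) := by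
    ext s
    have : HasDerivAt (fun s : ℝ => (v : ℝ) * s ^ 2 / 2) (v * (2 * s) / 2) s := by
      simpa using ((hasDerivAt_pow 2 s).const_mul (v : ℝ)).div_const 2
    rw [this.exp.deriv, id]
    ring
  rw [moment, moment, iteratedDeriv_succ', deriv_exp,
    iteratedDeriv_fun_mul contDiffAt_id (by fun_prop),
    Finset.sum_eq_single 1 (fun i _ hi => by simp [iteratedDeriv_id, hi]) (by simp),
    iteratedDeriv_const_mul_field]
  · simp [iteratedDeriv_id]; ring

section Hermite

open Polynomial

theorem integrable_eval_gaussianReal (v : NNReal) (p : ℝ[X]) :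
    Integrable (fun x => p.eval x) (gaussianReal 0 v) := by
  simp only [eval_eq_sum_range]
  exact integrable_finsetSum _ fun k _ => (integrable_pow_gaussianReal v k).const_mul _

theorem integral_X_mul_gaussianReal (v : NNReal) (p : ℝ[X]) :
    ∫ x, (X * p).eval x ∂(gaussianReal 0 v) =
      v * ∫ x, (derivative p).eval x ∂(gaussianReal 0 v) := by
  induction p using Polynomial.induction_on' with
  | add p q hp hq =>
    simp only [mul_add, derivative_add, eval_add]
    rw [integral_add (integrable_eval_gaussianReal v _) (integrable_eval_gaussianReal v _),
      integral_add (integrable_eval_gaussianReal v _) (integrable_eval_gaussianReal v _), hp, hq,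
      mul_add]
  | monomial n a =>
    simp only [X_mul_monomial, derivative_monomial, eval_monomial, integral_const_mul]
    cases n with
    | zero => simp
    | succ n =>
      rw [integral_pow_add_two_gaussianReal, Nat.add_sub_cancel]
      push_cast
      ring

theorem integral_hermite_mul_gaussianReal (n : ℕ) (q : ℝ[X]) :
    ∫ x, ((hermite n).map (algebraMap ℤ ℝ) * q).eval x ∂(gaussianReal 0 1) =
      ∫ x, (derivative^[n] q).eval x ∂(gaussianReal 0 1) := by
  induction n generalizing q with
  | zero => simp
  | succ n ih =>
    set h := (hermite n).map (algebraMap ℤ ℝ) with hh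
    have succ_mul : (hermite (n + 1)).map (algebraMap ℤ ℝ) * q =
        X * (h * q) - derivative h * q := by
      simp only [hermite_succ, Polynomial.map_sub, Polynomial.map_mul, map_X, hh, derivative_map]
      ring
    rw [succ_mul, Function.iterate_succ_apply, ← ih]
    simp only [eval_sub]
    rw [integral_sub (integrable_eval_gaussianReal 1 _) (integrable_eval_gaussianReal 1 _),
      integral_X_mul_gaussianReal, NNReal.coe_one, one_mul, derivative_mul, sub_eq_iff_eq_add',
      ← integral_add (integrable_eval_gaussianReal 1 _) (integrable_eval_gaussianReal 1 _)]
    simp only [eval_add]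

theorem iterate_derivative_hermite_of_le {m n : ℕ} (h : m ≤ n) :
    derivative^[n] (hermite m) = if m = n then (n.factorial : ℤ[X]) else 0 := by
  split_ifs with hmn
  · subst hmn
    rw [eq_C_of_natDegree_le_zero ((natDegree_iterate_derivative _ _).trans (by simp)),
      coeff_iterate_derivative, zero_add, coeff_hermite_self, Nat.descFactorial_self]
    simp
  · exact iterate_derivative_eq_zero (by simpa using lt_of_le_of_ne h hmn)

theorem integral_hermite_mul_hermite_gaussianReal (m n : ℕ) :
    ∫ x, ((hermite m).map (algebraMap ℤ ℝ) * (hermite n).map (algebraMap ℤ ℝ)).eval x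
      ∂(gaussianReal 0 1) = if m = n then (n.factorial : ℝ) else 0 := by
  wlog h : m ≤ n generalizing m n
  · rw [mul_comm, this n m (le_of_not_ge h)]
    split_ifs <;> grind
  rw [mul_comm, integral_hermite_mul_gaussianReal, iterate_derivative_map,
    iterate_derivative_hermite_of_le h]
  split_ifs <;> simp

theorem isOrthonormalSystem_hermite :
    IsOrthonormalSystem (gaussianReal 0 1) fun (k : ℕ) (x : ℝ) =>
      aeval (x : ℂ) (hermite k) / √(k.factorial : ℝ) := by
  have eq (m n : ℕ) (x : ℝ) : aeval (x : ℂ) (hermite m) / √(m.factorial : ℝ) *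
      conj (aeval (x : ℂ) (hermite n) / √(n.factorial : ℝ)) =
        ((√(m.factorial : ℝ) * √(n.factorial : ℝ))⁻¹ *
          ((hermite m).map (algebraMap ℤ ℝ) * (hermite n).map (algebraMap ℤ ℝ)).eval x :
          ℝ) := by
    have cast (k : ℕ) : aeval (x : ℂ) (hermite k) =
        (((hermite k).map (algebraMap ℤ ℝ)).eval x : ℝ) := by
      rw [eval_map_algebraMap]
      exact aeval_algebraMap_apply ℂ x (hermite k)
    simp only [cast, map_div₀, Complex.conj_ofReal, eval_mul]
    push_cast
    ring
  refine ⟨fun m n => ?_, fun m n => ?_⟩ <;> simp only [eq]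
  · exact ((integrable_eval_gaussianReal 1 _).const_mul _).ofReal
  · rw [integral_complex_ofReal, integral_const_mul, integral_hermite_mul_hermite_gaussianReal]
    split_ifs with h
    · rw [h, Real.mul_self_sqrt (by positivity), inv_mul_cancel₀ (by positivity),
        Complex.ofReal_one]
    · simp

end Hermite

/-- The law of `√((1 + t) / 2) x + i √((1 - t) / 2) y` for independent standard real Gaussian
variables `x` and `y`: the elliptic Gaussian law of a diagonal entry. -/
noncomputable def scalarLaw (t : ℝ) : Measure ℂ :=
  ((gaussianReal 0 1).prod (gaussianReal 0 1)).map fun x : ℝ × ℝ =>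
    (√((1 + t) / 2) : ℂ) * x.1 + Complex.I * √((1 - t) / 2) * x.2

instance isProbabilityMeasure_scalarLaw (t : ℝ) : IsProbabilityMeasure (scalarLaw t) :=
  Measure.isProbabilityMeasure_map (by fun_prop)

/-- The orthonormal polynomials of degree at most two of `scalarLaw t`. -/
noncomputable def scalarPoly (t : ℝ) : Fin 3 → ℂ → ℂ
  | 0, _ => 1
  | 1, p => p
  | 2, p => (p ^ 2 - t) / √2

theorem continuous_scalarPoly (t : ℝ) : ∀ k, Continuous (scalarPoly t k)
  | 0 => continuous_const
  | 1 => continuous_id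
  | 2 => by unfold scalarPoly; fun_prop

theorem ofReal_sqrt_two_sq : (√2 : ℂ) ^ 2 = 2 := by
  rw [← Complex.ofReal_pow, Real.sq_sqrt (by norm_num), Complex.ofReal_ofNat]

theorem isOrthonormalSystem_scalarPoly_one :
    IsOrthonormalSystem (gaussianReal 0 1) fun (k : Fin 3) (x : ℝ) => scalarPoly 1 k x := by
  convert isOrthonormalSystem_hermite.comp_injective (f := fun k : Fin 3 => (k : ℕ))
    Fin.val_injective using 3 with k x
  fin_cases k <;> simp [scalarPoly, Polynomial.hermite_succ, sq]

theorem isOrthonormalSystem_scalarPoly_combination {a b : ℝ} (hab : a ^ 2 + b ^ 2 = 1) :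
    IsOrthonormalSystem ((gaussianReal 0 1).prod (gaussianReal 0 1)) fun k x =>
      scalarPoly (a ^ 2 - b ^ 2) k (a * x.1 + Complex.I * b * x.2) := by
  let degrees : Fin 6 → Fin 3 × Fin 3 := ![(0, 0), (1, 0), (0, 1), (2, 0), (1, 1), (0, 2)]
  let C : Matrix (Fin 3) (Fin 6) ℂ :=
    !![1, 0, 0, 0, 0, 0;
       0, a, Complex.I * b, 0, 0, 0;
       0, 0, 0, a ^ 2, Complex.I * √2 * a * b, -b ^ 2]
  have hab' : (a : ℂ) ^ 2 + b ^ 2 = 1 := by exact_mod_cast hab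
  have hs := ofReal_sqrt_two_sq
  have hC : C * C.conjTranspose = 1 := by
    ext i j
    fin_cases i <;> fin_cases j <;>
      simp [C, Matrix.mul_apply, Fin.sum_univ_succ]
    · linear_combination hab' - b ^ 2 * Complex.I_sq
    · linear_combination (a ^ 2 + b ^ 2 + 1) * hab' + a ^ 2 * b ^ 2 * hs -
        a ^ 2 * b ^ 2 * √2 ^ 2 * Complex.I_sq
  convert ((isOrthonormalSystem_scalarPoly_one.prod
    isOrthonormalSystem_scalarPoly_one).comp_injective (f := degrees) (by decide)).linearCombination
      hC using 3 with k x
  fin_cases k <;>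
    simp [scalarPoly, C, degrees, Fin.sum_univ_succ]
  field_simp
  linear_combination (b : ℂ) ^ 2 * x.2 ^ 2 * Complex.I_sq -
    (a : ℂ) * b * x.1 * x.2 * Complex.I * hs

theorem isOrthonormalSystem_scalarPoly {t : ℝ} (h0 : -1 ≤ t) (h1 : t ≤ 1) :
    IsOrthonormalSystem (scalarLaw t) (scalarPoly t) := by
  rw [scalarLaw, IsOrthonormalSystem.map_iff (by fun_prop)
    fun k => (continuous_scalarPoly t k).aestronglyMeasurable]
  have ha : √((1 + t) / 2) ^ 2 = (1 + t) / 2 := Real.sq_sqrt (by linarith)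
  have hb : √((1 - t) / 2) ^ 2 = (1 - t) / 2 := Real.sq_sqrt (by linarith)
  have ht : t = √((1 + t) / 2) ^ 2 - √((1 - t) / 2) ^ 2 := by rw [ha, hb]; ring
  convert isOrthonormalSystem_scalarPoly_combination (a := √((1 + t) / 2)) (b := √((1 - t) / 2))
    (by rw [ha, hb]; ring) using 4
  rw [← ht]
  rfl

/-- The Wick polynomial of two entries `x` and `y` with `E[x y] = t`, in which `b` and `c` tell
whether `x` and `y` occur. -/
def pairWick {R : Type*} [CommRing R] (t : R) (b c : Bool) (x y : R) : R :=
  (if b then x else 1) * (if c then y else 1) - if b && c then t else 0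

theorem isOrthonormalSystem_pairWick {t : ℝ} (h0 : -1 ≤ t) (h1 : t ≤ 1) :
    IsOrthonormalSystem ((scalarLaw t).prod (scalarLaw t)) fun (b : Bool × Bool) p =>
      pairWick (t : ℂ) b.1 b.2 ((p.1 + Complex.I * p.2) / √2) ((p.1 - Complex.I * p.2) / √2) := by
  let degrees : Fin 5 → Fin 3 × Fin 3 := ![(0, 0), (1, 0), (0, 1), (2, 0), (0, 2)]
  let C : Matrix (Bool × Bool) (Fin 5) ℂ := Matrix.of fun
    | (false, false) => ![1, 0, 0, 0, 0]
    | (true, false) => ![0, 1 / √2, Complex.I / √2, 0, 0]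
    | (false, true) => ![0, 1 / √2, -Complex.I / √2, 0, 0]
    | (true, true) => ![0, 0, 0, 1 / √2, 1 / √2]
  have hs := ofReal_sqrt_two_sq
  have hC : C * C.conjTranspose = 1 := by
    ext ⟨b, c⟩ ⟨b', c'⟩
    cases b <;> cases c <;> cases b' <;> cases c' <;>
      simp [C, Matrix.mul_apply, Fin.sum_univ_succ] <;> field_simp <;> simp [hs] <;> norm_num
  convert ((isOrthonormalSystem_scalarPoly h0 h1).prod
    (isOrthonormalSystem_scalarPoly h0 h1)).comp_injective (f := degrees) (by decide)
      |>.linearCombination hC using 3 with b p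
  obtain ⟨b, c⟩ := b
  cases b <;> cases c <;> simp [pairWick, scalarPoly, C, degrees, Fin.sum_univ_succ] <;>
    field_simp
  · ring
  · linear_combination -p.2 ^ 2 * Complex.I_sq - t * hs

section Saturated

variable {α β M : Type*} [Fintype α] [DecidableEq β]

theorem prod_image_prod_fiber_of_saturated [CommMonoid M] {q : α → β} {S : Finset α}
    (hS : ∀ i j, q i = q j → i ∈ S → j ∈ S) (b : α → M) :
    ∏ s ∈ S.image q, ∏ i with q i = s, b i = ∏ i ∈ S, b i := by
  rw [← Finset.prod_fiberwise_of_maps_to fun i => Finset.mem_image_of_mem q]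
  refine Finset.prod_congr rfl fun s hs => Finset.prod_congr ?_ fun _ _ => rfl
  obtain ⟨i, hi, rfl⟩ := Finset.mem_image.1 hs
  ext j
  simp only [Finset.mem_filter, Finset.mem_univ, true_and]
  exact (and_iff_right_of_imp fun hj => hS i j hj.symm hi).symm

theorem prod_image_mul_add_eq_sum_saturated [DecidableEq α] [CommSemiring M] (q : α → β) (a : β → M)
    (b c : α → M) :
    ∏ s ∈ Finset.univ.image q, ((∏ i with q i = s, c i) * a s + ∏ i with q i = s, b i) =
      ∑ S : Finset α with ∀ i j, q i = q j → i ∈ S → j ∈ S,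
        (∏ i ∈ S, c i) * (∏ i ∈ Sᶜ, b i) * ∏ s ∈ S.image q, a s := by
  rw [Finset.prod_add]
  symm
  refine Finset.sum_bij' (fun S _ => S.image q) (fun T _ => Finset.univ.filter (q · ∈ T))
    (fun S _ => Finset.mem_powerset.2 (Finset.image_subset_image (Finset.subset_univ S)))
    (fun T _ => ?_) (fun S hS => ?_) (fun T hT => ?_) (fun S hS => ?_)
  · simp +contextual
  · ext i
    simp only [Finset.mem_filter, Finset.mem_univ, true_and, Finset.mem_image] at hS ⊢
    exact ⟨fun ⟨j, hj, hji⟩ => hS j i hji hj, fun hi => ⟨i, hi, rfl⟩⟩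
  · ext s
    simp only [Finset.mem_powerset, Finset.subset_iff, Finset.mem_filter, Finset.mem_univ,
      true_and, Finset.mem_image] at hT ⊢
    refine ⟨fun ⟨_, hj, hjs⟩ => hjs ▸ hj, fun hs => ?_⟩
    obtain ⟨i, hi⟩ := hT hs
    exact ⟨i, hi ▸ hs, hi⟩
  · have saturated : ∀ i j, q i = q j → i ∈ S → j ∈ S := (Finset.mem_filter.1 hS).2
    have saturated_compl (i j : α) (hij : q i = q j) (hi : i ∈ Sᶜ) : j ∈ Sᶜ :=
      Finset.mem_compl.2 fun hj => Finset.mem_compl.1 hi (saturated j i hij.symm hj)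
    have image_compl : Finset.univ.image q \ S.image q = Sᶜ.image q := by
      ext s
      simp only [Finset.mem_sdiff, Finset.mem_image, Finset.mem_univ, true_and, Finset.mem_compl]
      exact ⟨fun ⟨⟨i, hi⟩, hs⟩ => ⟨i, fun hiS => hs ⟨i, hiS, hi⟩, hi⟩,
        fun ⟨i, hiS, hi⟩ =>
          ⟨⟨i, hi⟩, fun ⟨j, hj, hjs⟩ => hiS (saturated j i (hjs.trans hi.symm) hj)⟩⟩
    rw [image_compl, Finset.prod_mul_distrib, prod_image_prod_fiber_of_saturated saturated,
      prod_image_prod_fiber_of_saturated saturated_compl, mul_right_comm]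

end Saturated

section InvolutiveOff

variable {ι : Type*}

/-- `σ` maps the complement of `S` to itself and is an involution there. -/
def IsInvolutiveOff (σ : Equiv.Perm ι) (S : Finset ι) : Prop :=
  (∀ i, σ i ∈ S ↔ i ∈ S) ∧ ∀ i ∉ S, σ (σ i) = i

theorem isInvolutiveOff_iff {σ : Equiv.Perm ι} {S : Finset ι} :
    IsInvolutiveOff σ S ↔
      (∀ i j, s(i, σ i) = s(j, σ j) → i ∈ S → j ∈ S) ∧ ∀ i ∉ S, σ (σ i) = i := by
  refine and_congr_left fun h => ⟨fun invariant i j hij hi => ?_, fun saturated i => ?_⟩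
  · rcases Sym2.eq_iff.1 hij with ⟨rfl, -⟩ | ⟨-, rfl⟩
    · exact hi
    · exact (invariant i).2 hi
  · by_cases swapped : σ (σ i) = i
    · have same : s(i, σ i) = s(σ i, σ (σ i)) := by rw [swapped, Sym2.eq_swap]
      exact ⟨saturated _ _ same.symm, saturated _ _ same⟩
    · have hi : i ∈ S := by_contra fun hi => swapped (h i hi)
      have hσi : σ i ∈ S := by_contra fun hσi => swapped (σ.injective (h _ hσi))
      exact iff_of_true hσi hi

variable [DecidableEq ι]

instance [Fintype ι] (σ : Equiv.Perm ι) : DecidablePred (IsInvolutiveOff σ) := fun _ =>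
  inferInstanceAs (Decidable (_ ∧ _))

/-- The graph of `f` over `S`. -/
def graphOn (f : ι → ι) (S : Finset ι) : Finset (ι × ι) :=
  S.image fun i => (i, f i)

theorem mem_graphOn {f : ι → ι} {S : Finset ι} {e : ι × ι} :
    e ∈ graphOn f S ↔ e.1 ∈ S ∧ f e.1 = e.2 := by
  simp only [graphOn, Finset.mem_image, Prod.ext_iff]
  exact ⟨fun ⟨i, hi, h1, h2⟩ => h1 ▸ ⟨hi, h2⟩, fun ⟨h1, h2⟩ => ⟨e.1, h1, rfl, h2⟩⟩

end InvolutiveOff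

theorem prod_filter_eq_prod_filter_ite_mem {α M : Type*} [Fintype α] [DecidableEq α]
    [CommMonoid M] (F : Finset α) (p : α → Prop) [DecidablePred p] (f : α → M) :
    ∏ e ∈ F with p e, f e = ∏ e with p e, if e ∈ F then f e else 1 := by
  rw [← Finset.prod_filter, Finset.filter_filter]
  exact Finset.prod_congr (by ext; simp [and_comm]) fun _ _ => rfl

theorem filter_mk_eq_mk {ι : Type*} [Fintype ι] [DecidableEq ι] (i j : ι) :
    Finset.univ.filter (fun e : ι × ι => s(e.1, e.2) = s(i, j)) = {(i, j), (j, i)} := by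
  ext ⟨a, b⟩
  simp

section WickProduct

variable {ι R : Type*} [Fintype ι] [DecidableEq ι] [CommRing R]

/-- The Wick polynomial of the entries of `A` at the positions `e ∈ F` whose underlying unordered
pair is `s`. Only a full pair of transposed off-diagonal entries is corrected, by `t`. -/
def wickFactor (t : R) (F : Finset (ι × ι)) (A : Matrix ι ι R) (s : Sym2 ι) : R :=
  ∏ e ∈ F with s(e.1, e.2) = s, A e.1 e.2 -
    if ¬ s.IsDiag ∧ ∀ e : ι × ι, s(e.1, e.2) = s → e ∈ F then t else 0

/-- The Wick product of the entries of `A` at the positions in `F`, for entries with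
`E[A i j * A j i] = t` when `i ≠ j`. -/
def wickProd (t : R) (F : Finset (ι × ι)) (A : Matrix ι ι R) : R :=
  ∏ s, wickFactor t F A s

theorem wickFactor_congr (t : R) {F G : Finset (ι × ι)} (A : Matrix ι ι R) {s : Sym2 ι}
    (h : ∀ e : ι × ι, s(e.1, e.2) = s → (e ∈ F ↔ e ∈ G)) :
    wickFactor t F A s = wickFactor t G A s := by
  have filter_eq : F.filter (fun e => s(e.1, e.2) = s) = G.filter fun e => s(e.1, e.2) = s := by
    ext e
    simpa only [Finset.mem_filter] using and_congr_left (h e)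
  simp only [wickFactor, filter_eq, forall_congr' fun e => imp_congr_right (h e)]

theorem wickFactor_empty (t : R) (A : Matrix ι ι R) (s : Sym2 ι) : wickFactor t ∅ A s = 1 := by
  induction s with
  | h i j =>
    have not_full : ¬ ∀ e : ι × ι, s(e.1, e.2) = s(i, j) → e ∈ (∅ : Finset (ι × ι)) := fun h =>
      Finset.notMem_empty _ (h (i, j) rfl)
    rw [wickFactor, Finset.filter_empty, Finset.prod_empty, if_neg fun h => not_full h.2, sub_zero]

theorem wickFactor_diag (t : R) (F : Finset (ι × ι)) (A : Matrix ι ι R) (i : ι) :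
    wickFactor t F A s(i, i) = if (i, i) ∈ F then A i i else 1 := by
  rw [wickFactor, prod_filter_eq_prod_filter_ite_mem, filter_mk_eq_mk, Finset.pair_eq_singleton,
    Finset.prod_singleton]
  simp

theorem wickFactor_mk_of_ne (t : R) (F : Finset (ι × ι)) (A : Matrix ι ι R) {i j : ι}
    (hij : i ≠ j) :
    wickFactor t F A s(i, j) =
      pairWick t (decide ((i, j) ∈ F)) (decide ((j, i) ∈ F)) (A i j) (A j i) := by
  have pair_ne : (i, j) ≠ (j, i) := fun h => hij (congrArg Prod.fst h)
  rw [wickFactor, prod_filter_eq_prod_filter_ite_mem, filter_mk_eq_mk, Finset.prod_pair pair_ne]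
  simp [pairWick, hij]

theorem filter_mk_apply_eq (σ : Equiv.Perm ι) (i : ι) :
    Finset.univ.filter (fun j => s(j, σ j) = s(i, σ i)) =
      if σ (σ i) = i then {i, σ i} else {i} := by
  ext j
  split_ifs with h <;> simp only [Finset.mem_filter, Finset.mem_univ, true_and, Sym2.eq_iff,
    Finset.mem_insert, Finset.mem_singleton] <;> grind

theorem prod_filter_graphOn {σ : Equiv.Perm ι} (A : Matrix ι ι R) (s : Sym2 ι) :
    ∏ e ∈ graphOn σ Finset.univ with s(e.1, e.2) = s, A e.1 e.2 =
      ∏ i with s(i, σ i) = s, A i (σ i) := by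
  rw [graphOn, Finset.filter_image, Finset.prod_image]
  exact fun _ _ _ _ h => congrArg Prod.fst h

theorem prod_fiber_sub_eq {t r w : R} (hr : r ^ 2 = t) (σ : Equiv.Perm ι) (A : Matrix ι ι R)
    (i : ι) :
    ∏ j with s(j, σ j) = s(i, σ i), ((if σ j = j then w else 0) - A j (σ j)) =
      (∏ j with s(j, σ j) = s(i, σ i), -1) *
          wickFactor t (graphOn σ Finset.univ) A s(i, σ i) +
        ∏ j with s(j, σ j) = s(i, σ i), if σ j = j then w else if σ (σ j) = j then r else 0 := by
  have full_iff : (∀ e : ι × ι, s(e.1, e.2) = s(i, σ i) → e ∈ graphOn σ Finset.univ) ↔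
      σ (σ i) = i := by
    simp only [mem_graphOn, Sym2.eq_iff, Finset.mem_univ, true_and, Prod.forall]
    exact ⟨fun h => h _ _ (.inr ⟨rfl, rfl⟩), by rintro h a b (⟨rfl, rfl⟩ | ⟨rfl, rfl⟩) <;> simp [h]⟩
  simp only [wickFactor, prod_filter_graphOn, full_iff, Sym2.mk_isDiag_iff, filter_mk_apply_eq]
  by_cases fixed : σ i = i
  · simp [fixed]; ring
  by_cases swapped : σ (σ i) = i
  · simp only [swapped, if_true, Finset.prod_pair (Ne.symm fixed)]
    simp [fixed, Ne.symm fixed, ← hr]; ring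
  · simp [fixed, swapped]

theorem wickProd_graphOn (t : R) {σ : Equiv.Perm ι} {S : Finset ι}
    (hS : ∀ i j, s(i, σ i) = s(j, σ j) → i ∈ S → j ∈ S) (A : Matrix ι ι R) :
    wickProd t (graphOn σ S) A =
      ∏ s ∈ S.image fun i => s(i, σ i), wickFactor t (graphOn σ Finset.univ) A s := by
  rw [wickProd, ← Finset.prod_subset (Finset.subset_univ (S.image fun i => s(i, σ i)))]
  · refine Finset.prod_congr rfl fun s hs => wickFactor_congr t A ?_
    rintro ⟨a, b⟩ rfl
    obtain ⟨i, hi, his⟩ := Finset.mem_image.1 hs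
    simp only [mem_graphOn, Finset.mem_univ, and_congr_left_iff, iff_true]
    rintro rfl
    exact hS i a his hi
  · refine fun s _ hs => (wickFactor_congr t A ?_).trans (wickFactor_empty t A s)
    rintro ⟨a, b⟩ rfl
    simp only [mem_graphOn, Finset.notMem_empty, iff_false, not_and]
    rintro ha rfl
    exact hs (Finset.mem_image_of_mem _ ha)

theorem prod_sub_eq_sum_wickProd {t r : R} (hr : r ^ 2 = t) (w : R) (σ : Equiv.Perm ι)
    (A : Matrix ι ι R) :
    ∏ i, ((if σ i = i then w else 0) - A i (σ i)) =
      ∑ S with IsInvolutiveOff σ S, ((-1) ^ S.card * ∏ i ∈ Sᶜ, if σ i = i then w else r) *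
        wickProd t (graphOn σ S) A := by
  let weight (i : ι) : R := if σ i = i then w else if σ (σ i) = i then r else 0
  have weight_eq {i : ι} (hi : σ (σ i) = i) : weight i = if σ i = i then w else r := by
    simp only [weight, hi, if_true]
  have weight_eq_zero {i : ι} (hi : σ (σ i) ≠ i) : weight i = 0 := by
    have : σ i ≠ i := fun h => hi (by rw [h, h])
    simp only [weight, hi, this, if_false]
  rw [← Finset.prod_fiberwise_of_maps_to fun i _ =>
      Finset.mem_image_of_mem (fun i => s(i, σ i)) (Finset.mem_univ i),
    Finset.prod_congr rfl (g := fun s => (∏ j with s(j, σ j) = s, -1) *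
      wickFactor t (graphOn σ Finset.univ) A s + ∏ j with s(j, σ j) = s, weight j)
      fun s hs => ?_, prod_image_mul_add_eq_sum_saturated]
  · symm
    refine Finset.sum_subset_zero_on_sdiff (fun S hS => ?_) (fun S hS => ?_) fun S hS => ?_
    all_goals simp only [Finset.mem_sdiff, Finset.mem_filter, Finset.mem_univ, true_and,
      isInvolutiveOff_iff, not_and, not_forall] at hS ⊢
    · exact hS.1
    · obtain ⟨i, hi, hσ⟩ := hS.2 hS.1
      rw [Finset.prod_eq_zero (Finset.mem_compl.2 hi) (weight_eq_zero hσ), mul_zero, zero_mul]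
    · rw [wickProd_graphOn t hS.1, Finset.prod_const, Finset.prod_congr rfl fun i hi =>
        (weight_eq (hS.2 i (Finset.mem_compl.1 hi))).symm]
  · obtain ⟨i, -, rfl⟩ := Finset.mem_image.1 hs
    exact prod_fiber_sub_eq hr σ A i

end WickProduct

section Law

/-- The matrix with diagonal entries `p (i, i)` and, for `i < j`, transposed entries
`(p (i, j) ± i p (j, i)) / √2`. For real `p` this is `hermitianOfReal`, and it has the elliptic
Ginibre law when the `p e` are independent with law `scalarLaw t`. -/
noncomputable def matrixOfComplex (n : ℕ) (p : Fin n × Fin n → ℂ) : Matrix (Fin n) (Fin n) ℂ :=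
  Matrix.of fun i j =>
    if i = j then p (i, i)
    else if i < j then (p (i, j) + Complex.I * p (j, i)) / (√2 : ℂ)
    else (p (j, i) - Complex.I * p (i, j)) / (√2 : ℂ)

variable {n : ℕ}

theorem measurable_matrixOfComplex : Measurable (matrixOfComplex n) := by
  refine measurable_pi_lambda _ fun i => measurable_pi_lambda _ fun j => ?_
  simp only [matrixOfComplex, Matrix.of_apply]
  split_ifs <;> fun_prop

theorem map_scalarCombination_eq_pi (ι : Type*) [Fintype ι] (t : ℝ) :
    ((Measure.pi fun _ : ι => gaussianReal 0 1).prod (Measure.pi fun _ : ι => gaussianReal 0 1)).map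
        (fun x e => (√((1 + t) / 2) : ℂ) * x.1 e + Complex.I * √((1 - t) / 2) * x.2 e) =
      Measure.pi fun _ : ι => scalarLaw t := by
  rw [← (measurePreserving_arrowProdEquivProdArrow ℝ ℝ ι (fun _ => gaussianReal 0 1)
    fun _ => gaussianReal 0 1).map_eq, Measure.map_map (by fun_prop) (by fun_prop)]
  unfold scalarLaw
  rw [← Measure.pi_map_pi fun _ => by fun_prop]
  rfl

theorem ellipticGinibreLaw_eq_map_pi (n : ℕ) (t : ℝ) :
    ellipticGinibreLaw n t =
      (Measure.pi fun _ : Fin n × Fin n => scalarLaw t).map (matrixOfComplex n) := by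
  have combination : ellipticCombination n t ∘ Prod.map (hermitianOfReal n) (hermitianOfReal n) =
      matrixOfComplex n ∘ fun x e =>
        (√((1 + t) / 2) : ℂ) * x.1 e + Complex.I * √((1 - t) / 2) * x.2 e := by
    ext x i j
    simp only [ellipticCombination, Function.comp_apply, Prod.map_fst, Prod.map_snd,
      hermitianOfReal, matrixOfComplex, Matrix.add_apply, Matrix.smul_apply, Matrix.of_apply,
      smul_eq_mul]
    split_ifs <;> ring
  have measurable_hermitian := measurable_hermitianOfReal n
  rw [ellipticGinibreLaw, gueLaw, Measure.map_prod_map _ _ measurable_hermitian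
    measurable_hermitian, Measure.map_map (measurable_ellipticCombination n t)
      (measurable_hermitian.prodMap measurable_hermitian), combination,
    ← map_scalarCombination_eq_pi, Measure.map_map measurable_matrixOfComplex (by fun_prop)]

end Law

section Orthonormality

variable {n : ℕ} {t : ℝ}

theorem isOrthonormalSystem_diagEntry (h0 : -1 ≤ t) (h1 : t ≤ 1) (i : Fin n) :
    IsOrthonormalSystem (Measure.pi fun _ : Fin n × Fin n => scalarLaw t) fun (b : Bool) p =>
      if b then matrixOfComplex n p i i else 1 := by
  have law := (measurePreserving_eval (fun _ : Fin n × Fin n => scalarLaw t) (i, i)).map_eq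
  have system := isOrthonormalSystem_scalarPoly h0 h1
  rw [← law, IsOrthonormalSystem.map_iff (measurable_pi_apply _).aemeasurable
    fun k => (continuous_scalarPoly t k).aestronglyMeasurable] at system
  convert system.comp_injective (f := fun b : Bool => if b then (1 : Fin 3) else 0) (by decide)
    using 3 with b p
  cases b <;> simp [scalarPoly, matrixOfComplex]

theorem isOrthonormalSystem_transposedEntries (h0 : -1 ≤ t) (h1 : t ≤ 1) {i j : Fin n}
    (hij : i < j) :
    IsOrthonormalSystem (Measure.pi fun _ : Fin n × Fin n => scalarLaw t) fun (b : Bool × Bool) p =>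
      pairWick (t : ℂ) b.1 b.2 (matrixOfComplex n p i j) (matrixOfComplex n p j i) := by
  have pair_ne : (i, j) ≠ (j, i) := fun h => hij.ne (congrArg Prod.fst h)
  have independent := (iIndepFun_pi (μ := fun _ : Fin n × Fin n => scalarLaw t)
    (X := fun _ => id) fun _ => aemeasurable_id).indepFun pair_ne
  have law : (Measure.pi fun _ : Fin n × Fin n => scalarLaw t).map
      (fun p => (p (i, j), p (j, i))) = (scalarLaw t).prod (scalarLaw t) := by
    refine ((indepFun_iff_map_prod_eq_prod_map_map (measurable_pi_apply _).aemeasurable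
      (measurable_pi_apply _).aemeasurable).1 independent).trans ?_
    congr 1 <;> exact (measurePreserving_eval _ _).map_eq
  have system := isOrthonormalSystem_pairWick h0 h1
  rw [← law, IsOrthonormalSystem.map_iff (by fun_prop) fun b => ?_] at system
  · simpa [matrixOfComplex, hij, hij.ne, hij.ne', hij.not_gt, Function.comp_def] using system
  · unfold pairWick
    split_ifs <;> fun_prop

theorem isOrthonormalSystem_wickFactor (h0 : -1 ≤ t) (h1 : t ≤ 1) (s : Sym2 (Fin n)) :
    IsOrthonormalSystem (Measure.pi fun _ : Fin n × Fin n => scalarLaw t)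
      fun (K : Finset {e : Fin n × Fin n // s(e.1, e.2) = s}) p =>
        wickFactor (t : ℂ) (K.map (Function.Embedding.subtype _)) (matrixOfComplex n p) s := by
  obtain ⟨i, j, hij, rfl⟩ : ∃ i j, i ≤ j ∧ s(i, j) = s :=
    ⟨s.inf, s.sup, s.inf_le_sup, Sym2.sortEquiv.symm_apply_apply s⟩
  obtain rfl | hij := hij.eq_or_lt
  · let bits (K : Finset {e : Fin n × Fin n // s(e.1, e.2) = s(i, i)}) : Bool := ⟨(i, i), rfl⟩ ∈ K
    have bits_injective : Function.Injective bits := fun K L h => by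
      ext ⟨⟨a, b⟩, hab⟩
      obtain ⟨rfl, rfl⟩ : a = i ∧ b = i := by simpa using hab
      simpa [bits] using h
    convert (isOrthonormalSystem_diagEntry h0 h1 i).comp_injective bits_injective using 3 with K p
    simp [bits, wickFactor_diag]
  · let bits (K : Finset {e : Fin n × Fin n // s(e.1, e.2) = s(i, j)}) : Bool × Bool :=
      (⟨(i, j), rfl⟩ ∈ K, ⟨(j, i), Sym2.eq_swap⟩ ∈ K)
    have bits_injective : Function.Injective bits := fun K L h => by
      obtain ⟨upper, lower⟩ : (_ ∈ K ↔ _ ∈ L) ∧ (_ ∈ K ↔ _ ∈ L) := by simpa [bits] using h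
      ext ⟨⟨a, b⟩, hab⟩
      obtain ⟨rfl, rfl⟩ | ⟨rfl, rfl⟩ := Sym2.eq_iff.1 hab
      exacts [upper, lower]
    convert (isOrthonormalSystem_transposedEntries h0 h1 hij).comp_injective bits_injective
      using 3 with K p
    simp [bits, wickFactor_mk_of_ne _ _ _ hij.ne]

theorem measurable_wickFactor (F : Finset (Fin n × Fin n)) (s : Sym2 (Fin n)) :
    Measurable fun A : Matrix (Fin n) (Fin n) ℂ => wickFactor (t : ℂ) F A s := by
  have entry (e : Fin n × Fin n) : Measurable fun A : Matrix (Fin n) (Fin n) ℂ => A e.1 e.2 :=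
    (measurable_pi_apply e.2).comp (measurable_pi_apply e.1)
  exact (Finset.measurable_prod _ fun e _ => entry e).sub_const _

theorem measurable_wickProd (F : Finset (Fin n × Fin n)) :
    Measurable (wickProd (ι := Fin n) (t : ℂ) F) :=
  Finset.measurable_prod _ fun s _ => measurable_wickFactor F s

theorem dependsOn_wickFactor_matrixOfComplex (F : Finset (Fin n × Fin n)) (s : Sym2 (Fin n)) :
    DependsOn (fun p => wickFactor (t : ℂ) F (matrixOfComplex n p) s)
      ((fun e => s(e.1, e.2)) ⁻¹' {s}) := by
  intro p q hpq
  have entry (e : Fin n × Fin n) (he : s(e.1, e.2) = s) :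
      matrixOfComplex n p e.1 e.2 = matrixOfComplex n q e.1 e.2 := by
    have same : p (e.1, e.2) = q (e.1, e.2) := hpq _ he
    have same_swap : p (e.2, e.1) = q (e.2, e.1) := hpq _ (Sym2.eq_swap.trans he)
    simp only [matrixOfComplex, Matrix.of_apply, same, same_swap]
    split_ifs with diag
    · rw [← diag] at same
      exact same
    all_goals rfl
  simp only [wickFactor]
  rw [Finset.prod_congr rfl fun e he => entry e (Finset.mem_filter.1 he).2]

theorem isOrthonormalSystem_wickProd (h0 : -1 ≤ t) (h1 : t ≤ 1) :
    IsOrthonormalSystem (ellipticGinibreLaw n t) fun F => wickProd (ι := Fin n) (t : ℂ) F := by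
  rw [ellipticGinibreLaw_eq_map_pi, IsOrthonormalSystem.map_iff
    measurable_matrixOfComplex.aemeasurable fun F => (measurable_wickProd F).aestronglyMeasurable]
  have independent := iIndepFun_of_dependsOn_fiber (fun e => measurable_pi_apply e)
    (iIndepFun_pi (μ := fun _ : Fin n × Fin n => scalarLaw t)
      (X := fun _ => id) fun _ => aemeasurable_id) (fun e => s(e.1, e.2))
    (f := fun s p (K : Finset {e : Fin n × Fin n // s(e.1, e.2) = s}) =>
      wickFactor (t : ℂ) (K.map (Function.Embedding.subtype _)) (matrixOfComplex n p) s)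
    (fun s => measurable_pi_lambda _ fun K =>
      (measurable_wickFactor _ s).comp measurable_matrixOfComplex)
    fun s p q hpq => funext fun K => dependsOn_wickFactor_matrixOfComplex _ s hpq
  let restrict (F : Finset (Fin n × Fin n)) (s : Sym2 (Fin n)) :
      Finset {e : Fin n × Fin n // s(e.1, e.2) = s} := F.subtype _
  have restrict_injective : Function.Injective restrict := fun F G h => by
    ext e
    simpa [restrict] using Finset.ext_iff.1 (congrFun h s(e.1, e.2)) ⟨e, rfl⟩
  convert (IsOrthonormalSystem.prod_of_iIndepFun (isOrthonormalSystem_wickFactor h0 h1)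
    independent).comp_injective restrict_injective using 3 with F p
  simp only [Function.comp_apply, wickProd]
  refine Finset.prod_congr rfl fun s _ => wickFactor_congr _ _ fun e he => ?_
  simp [restrict, he]

end Orthonormality

section Involutions

variable {α : Type*} [Fintype α] [DecidableEq α]

theorem card_support_of_sq_eq_one {τ : Equiv.Perm α} (hτ : τ ^ 2 = 1) :
    τ.support.card = 2 * Multiset.card τ.cycleType := by
  rw [← Equiv.Perm.sum_cycleType, Equiv.Perm.cycleType_of_pow_prime_eq_one hτ,
    Multiset.sum_replicate, Multiset.card_replicate, smul_eq_mul, mul_comm]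

theorem sq_eq_one_and_card_support_iff {τ : Equiv.Perm α} {k : ℕ} :
    τ ^ 2 = 1 ∧ τ.support.card = 2 * k ↔ τ.cycleType = Multiset.replicate k 2 := by
  rw [Multiset.eq_replicate, ← Equiv.Perm.pow_prime_eq_one_iff, and_comm, and_congr_left_iff]
  intro hτ
  rw [card_support_of_sq_eq_one hτ]
  lia

theorem card_cycleType_eq_replicate_two {j k : ℕ} (h : Fintype.card α = 2 * k + j) :
    (Finset.univ.filter fun τ : Equiv.Perm α => τ.cycleType = Multiset.replicate k 2).card =
      (2 * k - 1).doubleFactorial * (2 * k + j).choose j := by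
  have count := Equiv.Perm.card_of_cycleType_mul_eq α (Multiset.replicate k 2)
  have denominator : ∏ n ∈ (Multiset.replicate k 2).toFinset,
      ((Multiset.replicate k 2).count n).factorial = k.factorial := by
    rcases k.eq_zero_or_pos with rfl | hk
    · rfl
    · simp [Multiset.toFinset_replicate, hk.ne']
  have fits : (Multiset.replicate k 2).sum ≤ Fintype.card α ∧
      ∀ a ∈ Multiset.replicate k 2, 2 ≤ a := by
    refine ⟨?_, fun a ha => (Multiset.eq_of_mem_replicate ha).ge⟩
    rw [Multiset.sum_replicate, smul_eq_mul]
    lia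
  have double_factorial : (2 * k - 1).doubleFactorial * (2 ^ k * k.factorial) =
      (2 * k).factorial := by
    cases k with
    | zero => rfl
    | succ l =>
      rw [← Nat.doubleFactorial_two_mul, mul_comm]
      exact (Nat.factorial_eq_mul_doubleFactorial (2 * l + 1)).symm
  have choose := Nat.choose_mul_factorial_mul_factorial (Nat.le_add_left j (2 * k))
  rw [if_pos fits, denominator, Multiset.sum_replicate, Multiset.prod_replicate, smul_eq_mul, h,
    mul_comm k 2, Nat.add_sub_cancel_left] at count
  rw [Nat.add_sub_cancel, ← double_factorial] at choose
  have positive : 0 < j.factorial * 2 ^ k * k.factorial := by positivity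
  refine Nat.eq_of_mul_eq_mul_right positive (count.trans (choose.symm.trans ?_))
  ring

theorem sum_sign_involutions_eq_coeff_hermite (j : ℕ) :
    ∑ τ : Equiv.Perm α with τ ^ 2 = 1 ∧ τ.support.card + j = Fintype.card α,
      (Equiv.Perm.sign τ : ℤ) = (Polynomial.hermite (Fintype.card α)).coeff j := by
  rcases Nat.even_or_odd (Fintype.card α + j) with even | odd
  · rcases lt_or_ge (Fintype.card α) j with hj | hj
    · rw [Polynomial.coeff_hermite_of_lt hj, Finset.filter_false_of_mem fun τ _ h => by lia,
        Finset.sum_empty]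
    obtain ⟨k, hk⟩ : ∃ k, Fintype.card α = 2 * k + j := ⟨(Fintype.card α - j) / 2, by grind⟩
    have involutions_eq : (Finset.univ.filter fun τ : Equiv.Perm α =>
        τ ^ 2 = 1 ∧ τ.support.card + j = Fintype.card α) =
        Finset.univ.filter fun τ => τ.cycleType = Multiset.replicate k 2 :=
      Finset.filter_congr fun τ _ => by
        rw [← sq_eq_one_and_card_support_iff, hk, Nat.add_right_cancel_iff]
    have sign_eq (τ : Equiv.Perm α) (hτ : τ ∈ Finset.univ.filter fun τ : Equiv.Perm α =>
        τ.cycleType = Multiset.replicate k 2) : (Equiv.Perm.sign τ : ℤ) = (-1) ^ k := by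
      rw [Equiv.Perm.sign_of_cycleType, (Finset.mem_filter.1 hτ).2]
      simp [pow_add, pow_mul]
    rw [involutions_eq, Finset.sum_congr rfl sign_eq, Finset.sum_const,
      card_cycleType_eq_replicate_two hk, hk, Polynomial.coeff_hermite_explicit, nsmul_eq_mul]
    push_cast
    ring
  · rw [Polynomial.coeff_hermite_of_odd_add odd, Finset.filter_false_of_mem fun τ _ h => ?_,
      Finset.sum_empty]
    rw [← h.2, card_support_of_sq_eq_one h.1] at odd
    grind

/-- The polynomial `r ^ k * He_k (x / r)` in the variable `x`, which is also defined
for `r = 0`. -/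
noncomputable def scaledHermite {R : Type*} [CommRing R] (r : R) (k : ℕ) : Polynomial R :=
  ((Polynomial.hermite k).map (Int.castRingHom R)).scaleRoots r

variable {R : Type*} [CommRing R]

theorem eval_scaledHermite [Nontrivial R] (r w : R) (k : ℕ) :
    (scaledHermite r k).eval w =
      ∑ j ∈ Finset.range (k + 1), ((Polynomial.hermite k).coeff j : R) * r ^ (k - j) * w ^ j := by
  have natDegree_eq : ((Polynomial.hermite k).map (Int.castRingHom R)).natDegree = k := by
    rw [(Polynomial.hermite_monic k).natDegree_map, Polynomial.natDegree_hermite]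
  simp only [scaledHermite, Polynomial.eval_eq_sum_range, Polynomial.natDegree_scaleRoots,
    Polynomial.coeff_scaleRoots, natDegree_eq, Polynomial.coeff_map, eq_intCast]

theorem sum_involutions_eq_eval_scaledHermite [Nontrivial R] (r w : R) :
    ∑ τ : Equiv.Perm α with τ ^ 2 = 1,
        ((Equiv.Perm.sign τ : ℤ) : R) * ∏ i, (if τ i = i then w else r) =
      (scaledHermite r (Fintype.card α)).eval w := by
  have support_le (τ : Equiv.Perm α) : τ.support.card ≤ Fintype.card α := Finset.card_le_univ _
  have weight (τ : Equiv.Perm α) : ∏ i, (if τ i = i then w else r) =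
      r ^ τ.support.card * w ^ (Fintype.card α - τ.support.card) := by
    rw [Finset.prod_ite, Finset.prod_const, Finset.prod_const, mul_comm, ← Finset.card_compl]
    congr 3
    ext i
    simp
  rw [eval_scaledHermite, ← Finset.sum_fiberwise_of_maps_to
    (g := fun τ => Fintype.card α - τ.support.card) (t := Finset.range (Fintype.card α + 1))
    fun τ _ => Finset.mem_range.2 (by lia)]
  refine Finset.sum_congr rfl fun j hj => ?_
  have hj := Finset.mem_range_succ_iff.1 hj
  rw [← sum_sign_involutions_eq_coeff_hermite, Int.cast_sum, Finset.sum_mul, Finset.sum_mul,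
    Finset.filter_filter]
  refine Finset.sum_congr (Finset.filter_congr fun τ _ => ?_) fun τ hτ => ?_
  · have := support_le τ
    exact and_congr_right fun _ => by lia
  · have := (Finset.mem_filter.1 hτ).2.2
    rw [weight, ← mul_assoc, show Fintype.card α - τ.support.card = j by lia,
      show τ.support.card = Fintype.card α - j by lia]

end Involutions

section DetExpansion

variable {ι R : Type*} [DecidableEq ι]

theorem isInvolutiveOff_subtypeCongr {S : Finset ι} (π : Equiv.Perm {i // i ∈ S})
    {τ : Equiv.Perm {i // i ∉ S}} (hτ : τ ^ 2 = 1) : IsInvolutiveOff (π.subtypeCongr τ) S := by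
  refine ⟨fun i => ?_, fun i hi => ?_⟩
  · by_cases hi : i ∈ S
    · simp [Equiv.Perm.subtypeCongr.left_apply π τ hi, hi]
    · simpa [Equiv.Perm.subtypeCongr.right_apply π τ hi, hi] using (τ ⟨i, hi⟩).2
  · rw [Equiv.Perm.subtypeCongr.right_apply π τ hi,
      Equiv.Perm.subtypeCongr.right_apply π τ (τ ⟨i, hi⟩).2]
    exact congrArg Subtype.val (Equiv.congr_fun (sq τ ▸ hτ) ⟨i, hi⟩)

/-- The graph of a permutation of a subset of `ι`. -/
def partialPermGraph (x : (S : Finset ι) × Equiv.Perm {i // i ∈ S}) : Finset (ι × ι) :=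
  graphOn (Equiv.Perm.ofSubtype x.2) x.1

theorem graphOn_subtypeCongr {S : Finset ι} (π : Equiv.Perm {i // i ∈ S})
    (τ : Equiv.Perm {i // i ∉ S}) :
    graphOn (π.subtypeCongr τ) S = partialPermGraph ⟨S, π⟩ := by
  refine Finset.image_congr fun i hi => Prod.ext rfl ?_
  rw [Equiv.Perm.subtypeCongr.left_apply _ _ hi, Equiv.Perm.ofSubtype_apply_of_mem π hi]

theorem partialPermGraph_injective : Function.Injective (partialPermGraph (ι := ι)) := by
  rintro ⟨S, π⟩ ⟨T, ρ⟩ h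
  have same (i j : ι) := Finset.ext_iff.1 h (i, j)
  simp only [partialPermGraph, mem_graphOn] at same
  obtain rfl : S = T := by
    ext i
    exact ⟨fun hi => ((same i _).1 ⟨hi, rfl⟩).1, fun hi => ((same i _).2 ⟨hi, rfl⟩).1⟩
  congr 1
  ext i
  simpa using ((same i _).1 ⟨i.2, rfl⟩).2.symm

variable [Fintype ι]

theorem sum_isInvolutiveOff {M : Type*} [AddCommMonoid M] (S : Finset ι)
    (f : Equiv.Perm ι → M) :
    ∑ σ with IsInvolutiveOff σ S, f σ =
      ∑ π : Equiv.Perm {i // i ∈ S}, ∑ τ : Equiv.Perm {i // i ∉ S} with τ ^ 2 = 1,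
        f (π.subtypeCongr τ) := by
  rw [← Finset.sum_product']
  symm
  refine Finset.sum_nbij (fun x => x.1.subtypeCongr x.2) (fun x hx => ?_)
    (Equiv.Perm.subtypeCongrHom_injective _).injOn (fun σ hσ => ?_) fun _ _ => rfl
  · have hτ := (Finset.mem_filter.1 (Finset.mem_product.1 hx).2).2
    exact Finset.mem_filter.2 ⟨Finset.mem_univ _, isInvolutiveOff_subtypeCongr x.1 hτ⟩
  · obtain ⟨invariant, involutive⟩ := (Finset.mem_filter.1 hσ).2
    have invariant_compl (i : ι) : σ i ∉ S ↔ i ∉ S := not_congr (invariant i)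
    refine ⟨(σ.subtypePerm invariant, σ.subtypePerm invariant_compl), ?_, ?_⟩
    · refine Finset.mem_product.2 ⟨Finset.mem_univ _, Finset.mem_filter.2 ⟨Finset.mem_univ _, ?_⟩⟩
      exact Equiv.ext fun i => Subtype.ext (involutive i i.2)
    · ext i
      by_cases hi : i ∈ S
      · simp [Equiv.Perm.subtypeCongr.left_apply _ _ hi]
      · simp [Equiv.Perm.subtypeCongr.right_apply _ _ hi]

theorem prod_compl_subtypeCongr {M : Type*} [CommMonoid M] (r w : M) {S : Finset ι}
    (π : Equiv.Perm {i // i ∈ S}) (τ : Equiv.Perm {i // i ∉ S}) :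
    (∏ i ∈ Sᶜ, if π.subtypeCongr τ i = i then w else r) = ∏ i, if τ i = i then w else r := by
  rw [Finset.prod_subtype Sᶜ (p := fun i => i ∉ S) fun _ => Finset.mem_compl]
  exact Finset.prod_congr rfl fun i _ => by
    simp only [Equiv.Perm.subtypeCongr.right_apply_subtype, Subtype.ext_iff]

variable [CommRing R]

/-- The coefficient of the Wick product over `partialPermGraph x` in `det (w - A)`. -/
noncomputable def detCoeff (r w : R) (x : (S : Finset ι) × Equiv.Perm {i // i ∈ S}) : R :=
  (-1) ^ x.1.card * ((Equiv.Perm.sign x.2 : ℤ) : R) *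
    (scaledHermite r (Fintype.card ι - x.1.card)).eval w

theorem sum_sign_mul_prod_subtypeCongr [Nontrivial R] (r w : R) {S : Finset ι}
    (π : Equiv.Perm {i // i ∈ S}) :
    ∑ τ : Equiv.Perm {i // i ∉ S} with τ ^ 2 = 1,
        ((Equiv.Perm.sign (π.subtypeCongr τ) : ℤ) : R) *
          ((-1) ^ S.card * ∏ i ∈ Sᶜ, if π.subtypeCongr τ i = i then w else r) =
      detCoeff r w ⟨S, π⟩ := by
  have card_compl : Fintype.card {i // i ∉ S} = Fintype.card ι - S.card := by
    rw [Fintype.card_subtype_compl, Fintype.card_coe]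
  have sign_mul (τ : Equiv.Perm {i // i ∉ S}) :
      Equiv.Perm.sign (π.subtypeCongr τ) = Equiv.Perm.sign π * Equiv.Perm.sign τ := by
    convert Equiv.Perm.sign_subtypeCongr π τ
  simp only [detCoeff, ← card_compl, ← sum_involutions_eq_eval_scaledHermite, Finset.mul_sum,
    prod_compl_subtypeCongr, sign_mul, Units.val_mul, Int.cast_mul]
  refine Finset.sum_congr rfl fun τ _ => ?_
  ring

theorem det_sub_eq_sum_wickProd [Nontrivial R] {t r : R} (hr : r ^ 2 = t) (w : R)
    (A : Matrix ι ι R) :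
    (w • (1 : Matrix ι ι R) - A).det =
      ∑ x, detCoeff r w x * wickProd t (partialPermGraph x) A := by
  have entry (σ : Equiv.Perm ι) (i : ι) : (w • (1 : Matrix ι ι R) - A).transpose (σ i) i =
      (if σ i = i then w else 0) - A i (σ i) := by
    simp [Matrix.one_apply, eq_comm]
  simp only [← Matrix.det_transpose (w • (1 : Matrix ι ι R) - A), Matrix.det_apply', entry,
    prod_sub_eq_sum_wickProd hr, Finset.mul_sum]
  rw [Finset.sum_comm' (t' := Finset.univ) (s' := fun S => {σ | IsInvolutiveOff σ S})
    (by simp), Fintype.sum_sigma]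
  refine Finset.sum_congr rfl fun S _ => ?_
  rw [sum_isInvolutiveOff]
  refine Finset.sum_congr rfl fun π _ => ?_
  simp only [graphOn_subtypeCongr, ← sum_sign_mul_prod_subtypeCongr, Finset.sum_mul, mul_assoc]

end DetExpansion

section SecondMoment

theorem norm_detCoeff_sq {ι : Type*} [Fintype ι] [DecidableEq ι] (r w : ℂ)
    (x : (S : Finset ι) × Equiv.Perm {i // i ∈ S}) :
    ‖detCoeff r w x‖ ^ 2 = ‖(scaledHermite r (Fintype.card ι - x.1.card)).eval w‖ ^ 2 := by
  rcases Int.units_eq_one_or (Equiv.Perm.sign x.2) with sign | sign <;> simp [detCoeff, sign]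

theorem sum_norm_detCoeff_sq {ι : Type*} [Fintype ι] [DecidableEq ι] (r w : ℂ) :
    ∑ x : (S : Finset ι) × Equiv.Perm {i // i ∈ S}, ‖detCoeff r w x‖ ^ 2 =
      (Fintype.card ι).factorial * ∑ k ∈ Finset.range (Fintype.card ι + 1),
        ‖(scaledHermite r k).eval w‖ ^ 2 / k.factorial := by
  simp only [norm_detCoeff_sq, Fintype.sum_sigma, Finset.sum_const, Finset.card_univ,
    Fintype.card_perm, Fintype.card_coe, nsmul_eq_mul]
  rw [← Finset.powerset_univ, Finset.sum_powerset_apply_card fun m => (m.factorial : ℝ) *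
    ‖(scaledHermite r (Fintype.card ι - m)).eval w‖ ^ 2, Finset.card_univ,
    ← Finset.sum_range_reflect, Finset.mul_sum]
  refine Finset.sum_congr rfl fun k hk => ?_
  have hk : k ≤ Fintype.card ι := Finset.mem_range_succ_iff.1 hk
  have factorial_ne_zero : (k.factorial : ℝ) ≠ 0 := Nat.cast_ne_zero.2 k.factorial_ne_zero
  rw [Nat.add_sub_cancel, Nat.sub_sub_self hk, nsmul_eq_mul, Nat.choose_symm hk,
    ← Nat.choose_mul_factorial_mul_factorial hk]
  push_cast
  field_simp

variable {n : ℕ} {t : ℝ} {r : ℂ}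

theorem integrable_norm_det_sub_sq (h0 : -1 ≤ t) (h1 : t ≤ 1) (hr : r ^ 2 = t) (w : ℂ) :
    Integrable (fun A => ‖(w • (1 : Matrix (Fin n) (Fin n) ℂ) - A).det‖ ^ 2)
      (ellipticGinibreLaw n t) := by
  simp only [det_sub_eq_sum_wickProd hr]
  exact ((isOrthonormalSystem_wickProd h0 h1).comp_injective
    partialPermGraph_injective).integrable_norm_sum_sq _

theorem integral_norm_det_sub_sq (h0 : -1 ≤ t) (h1 : t ≤ 1) (hr : r ^ 2 = t) (w : ℂ) :
    ∫ A, ‖(w • (1 : Matrix (Fin n) (Fin n) ℂ) - A).det‖ ^ 2 ∂ellipticGinibreLaw n t =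
      n.factorial * ∑ k ∈ Finset.range (n + 1),
        ‖(scaledHermite r k).eval w‖ ^ 2 / k.factorial := by
  simp only [det_sub_eq_sum_wickProd hr]
  rw [((isOrthonormalSystem_wickProd h0 h1).comp_injective
    partialPermGraph_injective).integral_norm_sum_sq, sum_norm_detCoeff_sq, Fintype.card_fin]

theorem norm_normalisedCharpoly_sq (t : ℝ) (A : Matrix (Fin n) (Fin n) ℂ)
    {z : ℂ} (hz : z ≠ 0) :
    ‖normalisedCharpoly n t A z‖ ^ 2 =
      ‖z‖ ^ (2 * n) / n ^ n * ‖Complex.exp (-(n * t * z ^ 2))‖ *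
        ‖((√n * g t z) • (1 : Matrix (Fin n) (Fin n) ℂ) - A).det‖ ^ 2 := by
  rcases eq_or_ne n 0 with rfl | hn
  · simp [normalisedCharpoly]
  have sqrt_ne_zero : (√n : ℂ) ≠ 0 := by simpa using hn
  have factor_out : (1 + (t : ℂ) * z ^ 2) • (1 : Matrix (Fin n) (Fin n) ℂ) - (z / √n) • A =
      (z / √n) • ((√n * g t z) • (1 : Matrix (Fin n) (Fin n) ℂ) - A) := by
    rw [smul_sub, smul_smul]
    congr 2
    rw [g]
    field_simp
  have norm_exp_sq : ‖Complex.exp (-(n * t * z ^ 2) / 2)‖ ^ 2 =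
      ‖Complex.exp (-(n * t * z ^ 2))‖ := by
    rw [← norm_pow, ← Complex.exp_nat_mul, Nat.cast_ofNat, mul_div_cancel₀ _ two_ne_zero]
  have norm_factor : (‖z / √n‖ ^ n) ^ 2 = ‖z‖ ^ (2 * n) / n ^ n := by
    rw [norm_div, Complex.norm_real, Real.norm_of_nonneg (Real.sqrt_nonneg _), ← pow_mul,
      mul_comm n 2, div_pow, pow_mul √n, Real.sq_sqrt n.cast_nonneg]
  rw [normalisedCharpoly, factor_out, Matrix.det_smul, Fintype.card_fin, norm_mul, norm_mul,
    norm_pow, mul_pow, mul_pow, norm_exp_sq, norm_factor]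
  ring

theorem norm_eval_scaledHermite_sqrt_sq (ht : 0 < t) (x : ℝ) (w : ℂ) (k : ℕ) :
    ‖(scaledHermite (√t : ℂ) k).eval (√x * w)‖ ^ 2 =
      t ^ k * ‖Polynomial.aeval (√(x / t) * w) (Polynomial.hermite k)‖ ^ 2 := by
  have sqrt_eq : (√x : ℂ) = √t * √(x / t) := by
    rw [← Complex.ofReal_mul, ← Real.sqrt_mul ht.le, mul_div_cancel₀ _ ht.ne']
  rw [scaledHermite, sqrt_eq, mul_assoc, Polynomial.scaleRoots_eval_mul,
    (Polynomial.hermite_monic k).natDegree_map, Polynomial.natDegree_hermite,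
    ← algebraMap_int_eq, Polynomial.eval_map_algebraMap, norm_mul, norm_pow, Complex.norm_real,
    Real.norm_of_nonneg (Real.sqrt_nonneg t), mul_pow, ← pow_mul, mul_comm k, pow_mul,
    Real.sq_sqrt ht.le]

end SecondMoment

end EllipticGinibre

theorem mainTheorem5_general {Ω : Type*} [MeasurableSpace Ω] (P : Measure Ω)
    (n : ℕ) (t : ℝ) (ht0 : -1 ≤ t) (ht1 : t ≤ 1)
    (A : Ω → Matrix (Fin n) (Fin n) ℂ)
    (hA : HasLaw A (EllipticGinibre.ellipticGinibreLaw n t) P)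
    (r : ℂ) (hr : r ^ 2 = t) (z : ℂ) (hz0 : z ≠ 0) :
    Integrable (fun ω => ‖EllipticGinibre.normalisedCharpoly n t (A ω) z‖ ^ 2) P ∧
    ∫ ω, ‖EllipticGinibre.normalisedCharpoly n t (A ω) z‖ ^ 2 ∂P =
      ((n.factorial : ℝ) * ‖z‖ ^ (2 * n) / (n : ℝ) ^ n)
        * ‖Complex.exp (-((n : ℂ) * (t : ℂ) * z ^ 2))‖
        * ∑ k ∈ Finset.range (n + 1),
            ‖(EllipticGinibre.scaledHermite r k).eval (√n * EllipticGinibre.g t z)‖ ^ 2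
              / (k.factorial : ℝ) := by
  have integrable := EllipticGinibre.integrable_norm_det_sub_sq (n := n) ht0 ht1 hr
    (√n * EllipticGinibre.g t z)
  simp only [EllipticGinibre.norm_normalisedCharpoly_sq t _ hz0]
  constructor
  · rw [← hA.map_eq] at integrable
    exact (integrable.comp_aemeasurable hA.aemeasurable).const_mul _
  · have second_moment := EllipticGinibre.integral_norm_det_sub_sq (n := n) ht0 ht1 hr
      (√n * EllipticGinibre.g t z)
    rw [← hA.integral_comp integrable.aestronglyMeasurable] at second_moment
    rw [integral_const_mul]
    refine (congrArg _ second_moment).trans ?_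
    ring

theorem mainTheorem5 {Ω : Type*} [MeasurableSpace Ω] (P : Measure Ω)
    (n : ℕ) (hn : 1 ≤ n) (t : ℝ) (ht0 : 0 < t) (ht1 : t ≤ 1)
    (A : Ω → Matrix (Fin n) (Fin n) ℂ)
    (hA : HasLaw A (EllipticGinibre.ellipticGinibreLaw n t) P)
    (z : ℂ) (hz : ‖z‖ < 1) (hz0 : z ≠ 0) :
    Integrable (fun ω => ‖EllipticGinibre.normalisedCharpoly n t (A ω) z‖ ^ 2) P ∧
    ∫ ω, ‖EllipticGinibre.normalisedCharpoly n t (A ω) z‖ ^ 2 ∂P =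
      ((n.factorial : ℝ) * ‖z‖ ^ (2 * n) / (n : ℝ) ^ n)
        * ‖Complex.exp (-((n : ℂ) * (t : ℂ) * z ^ 2))‖
        * ∑ k ∈ Finset.range (n + 1), t ^ k / (k.factorial : ℝ)
            * ‖Polynomial.aeval ((Real.sqrt ((n : ℝ) / t) : ℂ) * EllipticGinibre.g t z)
                (Polynomial.hermite k)‖ ^ 2 := by
  have sqrt_sq : (√t : ℂ) ^ 2 = t := by rw [← Complex.ofReal_pow, Real.sq_sqrt ht0.le]
  simpa only [EllipticGinibre.norm_eval_scaledHermite_sqrt_sq ht0, div_mul_eq_mul_div] using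
    mainTheorem5_general P n t (by linarith) ht1 A hA _ sqrt_sq z hz0
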